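/- Let $K\subset\mathbf R$ be an infinite compact set. For a function $f:K\to\mathbf R$ put $|f|_K=\sup_K|f|$. For $n\ge 1$ let $T_n(K)$ be a monic real polynomial of degree $n$ for which $|T_n(K)|_K$ is smallest among all monic real polynomials of degree $n$, and let $\mathrm{cap}(K)=\lim_{n\to\infty}|T_n(K)|_K^{1/n}$ (this limit exists). Assume $\mathrm{cap}(K)<1$. Let $B(K)=\{P\in\mathbf Z[T] : |P|_K<1\}$, let $J(K)=\{x\in K : P(x)=0 \text{ for all } P\in B(K)\}$, and let $J_0(K)$ be the set of those $\alpha\in J(K)$ all of whose conjugates over $\mathbf Q$ (in $\mathbf C$) are real and belong to $K$. Then: 1. $J_0(K)=J(K)$. 2. A continuous function $f:K\to\mathbf R$ is a uniform limit on $K$ of polynomials with integer coefficients ($f$ is $\mathbf Z[T]$-approximable) if and only if there is a polynomial $R\in\mathbf Z[T]$ with $f(\alpha)=R(\alpha)$ for all $\alpha\in J_0(K)$ ($f$ is $J_0(K)$-interpolable). -/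

import Mathlib

open Filter Topology Polynomial

noncomputable section

namespace FeketeKernel

/-- The norm `|f|_K`: the supremum of `|f|` on `K` (a maximum when `K` is compact and nonempty and
`f` is continuous on `K`). -/
def supNorm (K : Set ℝ) (f : ℝ → ℝ) : ℝ := sSup ((fun x => |f x|) '' K)

/-- The smallest norm `|P|_K` of a monic real polynomial `P` of degree `n`, that is, the norm
of the `n`-th Chebyshev polynomial of `K`. -/
def chebyshevNorm (K : Set ℝ) (n : ℕ) : ℝ :=
  sInf ((fun P : ℝ[X] => supNorm K (fun x => P.eval x)) '' {P | P.Monic ∧ P.natDegree = n})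

/-- The capacity radius `cap(K)`: the limit of `|T_n(K)|_K ^ (1 / n)`, where `T_n(K)` is the `n`-th
Chebyshev polynomial of `K`. The limit exists for compact `K`, see `tendsto_capacity`. -/
def capacity (K : Set ℝ) : ℝ :=
  limUnder atTop (fun n : ℕ => chebyshevNorm K n ^ (1 / (n : ℝ)))

/-- `B(K)`: the polynomials with integer coefficients whose norm on `K` is `< 1`. -/
def smallPolys (K : Set ℝ) : Set ℤ[X] := {P | supNorm K (fun x => aeval x P) < 1}

/-- The Fekete kernel `J(K)`: the points of `K` at which all elements of `B(K)` vanish. -/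
def J (K : Set ℝ) : Set ℝ := {x | x ∈ K ∧ ∀ P ∈ smallPolys K, aeval x P = 0}

/-- `J₀(K)`: the points of `J(K)` all of whose (complex) conjugates over `ℚ` are real and
belong to `K`. -/
def J₀ (K : Set ℝ) : Set ℝ :=
  {x | x ∈ J K ∧ ∀ z : ℂ, IsConjRoot ℚ (x : ℂ) z → ∃ y ∈ K, (y : ℂ) = z}

/-- `f` is the uniform limit on `K` of a sequence of polynomials with integer coefficients. -/
def IsApproximable (K : Set ℝ) (f : ℝ → ℝ) : Prop :=
  ∃ P : ℕ → ℤ[X], TendstoUniformlyOn (fun n x => aeval x (P n)) f atTop K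

/-- `f` coincides on `X` with a polynomial with integer coefficients. -/
def IsInterpolable (X : Set ℝ) (f : ℝ → ℝ) : Prop :=
  ∃ R : ℤ[X], ∀ x ∈ X, f x = aeval x R

theorem supNorm_nonneg (K : Set ℝ) (f : ℝ → ℝ) : 0 ≤ supNorm K f := by
  apply Real.sSup_nonneg
  rintro _ ⟨x, _, rfl⟩
  exact abs_nonneg _

theorem chebyshevNorm_nonneg (K : Set ℝ) (n : ℕ) : 0 ≤ chebyshevNorm K n := by
  apply Real.sInf_nonneg
  rintro _ ⟨P, _, rfl⟩
  exact supNorm_nonneg _ _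

theorem le_supNorm {K : Set ℝ} (hK : IsCompact K) {f : ℝ → ℝ} (hf : Continuous f) {x : ℝ}
    (hx : x ∈ K) : |f x| ≤ supNorm K f :=
  le_csSup (hK.image (continuous_abs.comp hf)).bddAbove ⟨x, hx, rfl⟩

theorem chebyshevNorm_le (K : Set ℝ) {P : ℝ[X]} (hP : P.Monic) :
    chebyshevNorm K P.natDegree ≤ supNorm K (fun x => P.eval x) := by
  apply csInf_le
  · refine ⟨0, ?_⟩
    rintro _ ⟨Q, _, rfl⟩
    exact supNorm_nonneg _ _
  · exact ⟨P, ⟨hP, rfl⟩, rfl⟩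

theorem chebyshevNorm_add_le {K : Set ℝ} (hK : IsCompact K) (m n : ℕ) :
    chebyshevNorm K (m + n) ≤ chebyshevNorm K m * chebyshevNorm K n := by
  have hne : ∀ k : ℕ, ((fun P : ℝ[X] => supNorm K (fun x => P.eval x)) ''
      {P | P.Monic ∧ P.natDegree = k}).Nonempty := fun k =>
    ⟨_, X ^ k, ⟨monic_X_pow k, natDegree_X_pow k⟩, rfl⟩
  have key : ∀ P Q : ℝ[X], P.Monic → Q.Monic → chebyshevNorm K (P.natDegree + Q.natDegree) ≤
      supNorm K (fun x => P.eval x) * supNorm K (fun x => Q.eval x) := by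
    intro P Q hP hQ
    rw [← hP.natDegree_mul hQ]
    refine (chebyshevNorm_le K (hP.mul hQ)).trans ?_
    apply Real.sSup_le
    · rintro _ ⟨x, hx, rfl⟩
      simp only [eval_mul, abs_mul]
      exact mul_le_mul (le_supNorm hK P.continuous hx) (le_supNorm hK Q.continuous hx)
        (abs_nonneg _) (supNorm_nonneg _ _)
    · exact mul_nonneg (supNorm_nonneg _ _) (supNorm_nonneg _ _)
  have h1 : ∀ P : ℝ[X], P.Monic → P.natDegree = m → chebyshevNorm K (m + n) ≤
      supNorm K (fun x => P.eval x) * chebyshevNorm K n := by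
    rintro P hP rfl
    rw [chebyshevNorm.eq_def K n, ← smul_eq_mul, ← Real.sInf_smul_of_nonneg (supNorm_nonneg _ _)]
    apply le_csInf ((hne n).image _)
    rintro _ ⟨_, ⟨Q, ⟨hQ, rfl⟩, rfl⟩, rfl⟩
    exact key P Q hP hQ
  rw [mul_comm, chebyshevNorm.eq_def K m, ← smul_eq_mul,
    ← Real.sInf_smul_of_nonneg (chebyshevNorm_nonneg _ _)]
  apply le_csInf ((hne m).image _)
  rintro _ ⟨_, ⟨P, ⟨hP, hd⟩, rfl⟩, rfl⟩
  simpa only [smul_eq_mul, mul_comm] using h1 P hP hd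

/-- For compact `K` the limit that defines `capacity K` exists. -/
theorem tendsto_capacity {K : Set ℝ} (hK : IsCompact K) :
    Tendsto (fun n : ℕ => chebyshevNorm K n ^ (1 / (n : ℝ))) atTop (𝓝 (capacity K)) := by
  apply tendsto_nhds_limUnder
  by_cases h0 : ∃ m, chebyshevNorm K m = 0
  · obtain ⟨m, hm⟩ := h0
    refine ⟨0, tendsto_const_nhds.congr' ?_⟩
    filter_upwards [eventually_ge_atTop (m + 1)] with n hn
    obtain ⟨k, rfl⟩ := Nat.exists_eq_add_of_le (show m ≤ n by omega)
    have h := chebyshevNorm_add_le hK m k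
    rw [hm, zero_mul] at h
    rw [le_antisymm h (chebyshevNorm_nonneg _ _), Real.zero_rpow]
    have : ((m + k : ℕ) : ℝ) ≠ 0 := by
      exact_mod_cast (by omega : m + k ≠ 0)
    positivity
  · push Not at h0
    have hpos : ∀ n, 0 < chebyshevNorm K n := fun n =>
      lt_of_le_of_ne (chebyshevNorm_nonneg _ _) (h0 n).symm
    have hsub : Subadditive (fun n => Real.log (chebyshevNorm K n)) := by
      intro m n
      rw [← Real.log_mul (h0 m) (h0 n)]
      exact Real.log_le_log (hpos _) (chebyshevNorm_add_le hK m n)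
    have heq : (fun n : ℕ => chebyshevNorm K n ^ (1 / (n : ℝ))) =
        fun n : ℕ => Real.exp (Real.log (chebyshevNorm K n) / n) := by
      funext n
      rw [Real.rpow_def_of_pos (hpos n), mul_one_div]
    rw [heq]
    by_cases hb : BddBelow (Set.range fun n : ℕ => Real.log (chebyshevNorm K n) / n)
    · exact ⟨_, (Real.continuous_exp.tendsto _).comp (hsub.tendsto_lim hb)⟩
    · refine ⟨0, Real.tendsto_exp_atBot.comp (tendsto_atBot.2 fun b => ?_)⟩
      have hex : ∃ n : ℕ, Real.log (chebyshevNorm K n) / n < min b 0 := by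
        by_contra hcon
        push Not at hcon
        exact hb ⟨min b 0, by rintro _ ⟨n, rfl⟩; exact hcon n⟩
      obtain ⟨n, hn⟩ := hex
      have hn0 : n ≠ 0 := by
        rintro rfl
        simp at hn
      filter_upwards [hsub.eventually_div_lt_of_div_lt hn0 hn] with p hp
      exact hp.le.trans (min_le_left _ _)

end FeketeKernel

end

/-! Capacity `< 1` gives a monic real `p` of positive degree with norm `< 1`. The products `X ^ i *
p ^ j` with `i < deg p` then form a monic basis with summable norms, so rounding coefficients in
high degree costs little (`exists_int_add_of_degree_lt`). Rounding powers of `p` leaves remainders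
of bounded degree; by Dirichlet's theorem some difference of two of them is nearly integral, which
makes `p` integral (`exists_monic_int`). Sums of even powers then yield a monic `s` in `B(K)` whose
zeros in `K` lie in `J(K)`, so `J(K)` is finite.

If `f` vanishes on `J(K)`, write `f` as nearly `s ^ (2 * m) * g` and round `g`: the rounding error
is bounded independently of `g`, and the factor makes it small. Hence interpolable functions are
approximable. Conversely, late approximants differ by elements of `B(K)`, so they agree on `J(K)`.

Truncation shows that an integer polynomial of absolute value `< 1` on `J(K)` vanishes there
(`aeval_eq_zero_of_abs_lt_one`). A nonzero such polynomial of degree at most `#J(K)` exists, so its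
complex roots are exactly `J(K)`, which is therefore closed under conjugation. -/

namespace FeketeKernel

/-! ### Simultaneous Diophantine approximation of coefficients -/

/-- A form of Dirichlet's approximation theorem: among infinitely many real polynomials of bounded
degree there are two whose difference is close to a polynomial with integer coefficients. -/
theorem exists_lt_abs_coeff_sub_sub_lt {d : ℕ} {G : ℕ → ℝ[X]} (hG : ∀ k, (G k).degree < d)
    {ε : ℝ} (hε : 0 < ε) : ∃ k l, k < l ∧ ∃ w : ℤ[X], w.degree < d ∧
      ∀ i, |(G l - G k).coeff i - w.coeff i| < ε := by
  let x : ℕ → Fin d → ℝ := fun k i => Int.fract ((G k).coeff i)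
  have hx : ∀ k, x k ∈ Metric.closedBall (0 : Fin d → ℝ) 1 := by
    intro k
    rw [mem_closedBall_zero_iff, pi_norm_le_iff_of_nonneg zero_le_one]
    intro i
    rw [Real.norm_of_nonneg (Int.fract_nonneg _)]
    exact (Int.fract_lt_one _).le
  -- Compactness replaces the pigeonhole principle: two vectors of fractional parts are close, and
  -- the differences of the floors give `w`.
  obtain ⟨a, -, φ, hφ, hlim⟩ := tendsto_subseq_of_bounded Metric.isBounded_closedBall hx
  obtain ⟨N, hN⟩ := Metric.cauchySeq_iff.1 hlim.cauchySeq ε hε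
  have hdist := hN (N + 1) (Nat.le_succ N) N le_rfl
  refine ⟨φ N, φ (N + 1), hφ (Nat.lt_succ_self N),
    ∑ i : Fin d, C (⌊(G (φ (N + 1))).coeff i⌋ - ⌊(G (φ N)).coeff i⌋) * X ^ (i : ℕ), ?_, ?_⟩
  · exact (degree_sum_fin_lt _)
  · intro i
    by_cases hi : i < d
    · have hc := (dist_pi_lt_iff hε).1 hdist ⟨i, hi⟩
      rw [Real.dist_eq] at hc
      have hsum : (∑ j : Fin d, C (⌊(G (φ (N + 1))).coeff j⌋ - ⌊(G (φ N)).coeff j⌋) *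
          X ^ (j : ℕ) : ℤ[X]).coeff i = ⌊(G (φ (N + 1))).coeff i⌋ - ⌊(G (φ N)).coeff i⌋ := by
        simp only [finsetSum_coeff, coeff_C_mul, coeff_X_pow]
        rw [Finset.sum_eq_single ⟨i, hi⟩]
        · simp
        · intro j _ hj
          have : i ≠ j := fun h => hj (Fin.ext h.symm)
          simp [this]
        · simp
      rw [hsum]
      convert hc using 2
      simp only [x, Function.comp_apply, Int.fract, coeff_sub]
      push_cast
      ring
    · have h0 : ∀ k, (G k).coeff i = 0 := fun k =>
        coeff_eq_zero_of_degree_lt ((hG k).trans_le (by exact_mod_cast not_lt.1 hi))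
      rw [coeff_sub, h0, h0, coeff_eq_zero_of_degree_lt
        ((degree_sum_fin_lt _).trans_le (by exact_mod_cast not_lt.1 hi))]
      simpa using hε

theorem abs_eval_le_of_abs_coeff_le {d : ℕ} {P : ℝ[X]} (hP : P.degree < d) {ε M x : ℝ}
    (hc : ∀ i, |P.coeff i| ≤ ε) (hx : |x| ≤ M) :
    |P.eval x| ≤ ε * ∑ i ∈ Finset.range d, M ^ i := by
  have hε : 0 ≤ ε := (abs_nonneg _).trans (hc 0)
  rcases eq_or_ne P 0 with rfl | h0
  · have hS : 0 ≤ ∑ i ∈ Finset.range d, M ^ i :=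
      Finset.sum_nonneg fun i _ => pow_nonneg ((abs_nonneg _).trans hx) _
    simpa using mul_nonneg hε hS
  rw [eval_eq_sum_range' ((natDegree_lt_iff_degree_lt h0).2 hP), Finset.mul_sum]
  refine (Finset.abs_sum_le_sum_abs _ _).trans (Finset.sum_le_sum fun i _ => ?_)
  rw [abs_mul, abs_pow]
  exact mul_le_mul (hc i) (pow_le_pow_left₀ (abs_nonneg _) hx _) (by positivity) hε

theorem aeval_eq_eval_map_intCast (P : ℤ[X]) (x : ℝ) :
    aeval x P = (P.map (Int.castRingHom ℝ)).eval x := by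
  rw [aeval_def, eval_map]
  rfl

/-- Dirichlet's approximation theorem for polynomials, with a bound for the values. -/
theorem exists_lt_abs_eval_sub_sub_lt {d : ℕ} {G : ℕ → ℝ[X]} (hG : ∀ k, (G k).degree < d)
    (M : ℝ) {ε : ℝ} (hε : 0 < ε) : ∃ k l, k < l ∧ ∃ w : ℤ[X], w.degree < d ∧
      (∀ i, |(G l - G k).coeff i - w.coeff i| < ε) ∧
      ∀ x, |x| ≤ M → |(G l).eval x - (G k).eval x - aeval x w| < ε := by
  set S : ℝ := ∑ i ∈ Finset.range d, |M| ^ i with hS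
  have hS0 : 0 ≤ S := Finset.sum_nonneg fun i _ => by positivity
  obtain ⟨k, l, hkl, w, hw, hc⟩ := exists_lt_abs_coeff_sub_sub_lt hG
    (show 0 < ε / (S + 1) by positivity)
  refine ⟨k, l, hkl, w, hw, fun i => (hc i).trans_le (div_le_self hε.le (by linarith)), ?_⟩
  intro x hx
  have hdeg : (G l - G k - w.map (Int.castRingHom ℝ)).degree < d := by
    refine (degree_sub_le _ _).trans_lt (max_lt ((degree_sub_le _ _).trans_lt ?_) ?_)
    · exact max_lt (hG l) (hG k)
    · exact degree_map_le.trans_lt hw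
  have h := abs_eval_le_of_abs_coeff_le (ε := ε / (S + 1)) (M := |M|) (x := x) hdeg
    (fun i => by simpa using (hc i).le) (hx.trans (le_abs_self M))
  rw [← hS] at h
  rw [aeval_eq_eval_map_intCast, ← eval_sub, ← eval_sub]
  refine h.trans_lt ?_
  rw [div_mul_eq_mul_div, div_lt_iff₀ (by positivity)]
  nlinarith

/-! ### Rounding along a monic basis -/

/-- Rounding of the coefficients of a real polynomial with respect to a sequence `b` of monic
polynomials, down to degree `m`. -/
theorem exists_int_add_of_degree_lt {K : Set ℝ} {b : ℕ → ℝ[X]} {c : ℕ → ℝ}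
    (hb : ∀ k, (b k).Monic) (hd : ∀ k, (b k).natDegree = k)
    (hc : ∀ k, ∀ x ∈ K, |(b k).eval x| ≤ c k) {m N : ℕ} (hmN : m ≤ N) :
    ∀ H : ℝ[X], H.degree < N → ∃ (W : ℤ[X]) (L : ℝ[X]), W.degree < N ∧ L.degree < m ∧
      ∀ x ∈ K, |H.eval x - aeval x W - L.eval x| ≤ ∑ k ∈ Finset.Ico m N, c k := by
  induction N, hmN using Nat.le_induction with
  | base =>
    intro H hH
    refine ⟨0, H, by simp [bot_lt_iff_ne_bot], hH, by simp⟩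
  | succ N hmN ih =>
    intro H hH
    set a := H.coeff N with ha
    -- Only the fractional part of the top coefficient is charged to `b N`; the integer part goes to
    -- `X ^ N`, since `b N` need not have integer coefficients.
    have hH' : (H - C (Int.fract a) * b N - C ((⌊a⌋ : ℤ) : ℝ) * X ^ N).degree <
        ((N : ℕ) : WithBot ℕ) := by
      rw [degree_lt_iff_coeff_zero] at hH ⊢
      intro i hi
      rcases hi.eq_or_lt with rfl | hi
      · have := (hb N).coeff_natDegree
        rw [hd] at this
        simp only [coeff_sub, coeff_C_mul, this, coeff_X_pow, ← ha, if_true, mul_one]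
        rw [sub_sub, Int.fract_add_floor, sub_self]
      · have h1 : (b N).coeff i = 0 := coeff_eq_zero_of_natDegree_lt (by rw [hd]; exact hi)
        simp [coeff_X_pow, h1, hH i hi, hi.ne']
    obtain ⟨W, L, hW, hL, h⟩ := ih _ hH'
    refine ⟨W + C ⌊a⌋ * X ^ N, L, ?_, hL, ?_⟩
    · refine (degree_add_le _ _).trans_lt (max_lt (hW.trans ?_) ?_)
      · exact_mod_cast Nat.lt_succ_self N
      · exact (degree_C_mul_X_pow_le _ _).trans_lt (by exact_mod_cast Nat.lt_succ_self N)
    · intro x hx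
      have h1 := h x hx
      have h2 : |Int.fract a * (b N).eval x| ≤ c N := by
        rw [abs_mul, abs_of_nonneg (Int.fract_nonneg a)]
        refine le_trans ?_ (hc N x hx)
        exact mul_le_of_le_one_left (abs_nonneg _) (Int.fract_lt_one a).le
      rw [Finset.sum_Ico_succ_top hmN]
      refine le_trans (le_of_eq ?_) ((abs_add_le _ _).trans (add_le_add h1 h2))
      congr 1
      simp only [eval_sub, eval_mul, eval_C, eval_pow, eval_X, map_add, map_mul, map_pow, aeval_X,
        eq_intCast, map_intCast, eval_intCast]
      ring

theorem summable_pow_div {r : ℝ} (h0 : 0 ≤ r) (h1 : r < 1) {n : ℕ} (hn : 0 < n) :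
    Summable fun k : ℕ => r ^ (k / n) := by
  have : NeZero n := ⟨hn.ne'⟩
  have hs : Summable fun p : ℕ × Fin n => r ^ p.1 * (1 : ℝ) :=
    (summable_geometric_of_lt_one h0 h1).mul_of_nonneg (g := fun _ : Fin n => (1 : ℝ))
      (Summable.of_finite) (fun _ => by positivity) (fun _ => zero_le_one)
  have := (Nat.divModEquiv n).summable_iff.2 hs
  refine this.congr fun k => ?_
  simp [Nat.divModEquiv]

/-- If a monic polynomial of positive degree is small on `K`, there is a sequence of monic
polynomials, one for each degree, whose norms on `K` have a finite sum. -/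
theorem exists_summable_basis {K : Set ℝ} {M : ℝ} (hM : ∀ x ∈ K, |x| ≤ M) {q : ℝ[X]}
    (hq : q.Monic) (hdeg : 0 < q.natDegree) {r : ℝ} (hr0 : 0 ≤ r) (hr1 : r < 1)
    (hqr : ∀ x ∈ K, |q.eval x| ≤ r) : ∃ (b : ℕ → ℝ[X]) (c : ℕ → ℝ), (∀ k, (b k).Monic) ∧
      (∀ k, (b k).natDegree = k) ∧ (∀ k, ∀ x ∈ K, |(b k).eval x| ≤ c k) ∧ (∀ k, 0 ≤ c k) ∧
      Summable c := by
  set n := q.natDegree with hn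
  refine ⟨fun k => X ^ (k % n) * q ^ (k / n), fun k => (max 1 |M|) ^ n * r ^ (k / n),
    fun k => (monic_X_pow _).mul (hq.pow _), fun k => ?_, fun k x hx => ?_, fun k => by positivity,
    (summable_pow_div hr0 hr1 hdeg).mul_left _⟩
  · rw [(monic_X_pow _).natDegree_mul (hq.pow _), natDegree_X_pow, hq.natDegree_pow, ← hn,
      mul_comm, Nat.mod_add_div]
  · simp only [eval_mul, eval_pow, eval_X, abs_mul, abs_pow]
    have h1 : |x| ^ (k % n) ≤ max 1 |M| ^ n :=
      (pow_le_pow_left₀ (abs_nonneg _) (((hM x hx).trans (le_abs_self M)).trans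
        (le_max_right 1 _)) _).trans (pow_le_pow_right₀ (le_max_left _ _) (Nat.mod_lt k hdeg).le)
    exact mul_le_mul h1 (pow_le_pow_left₀ (abs_nonneg _) (hqr x hx) _) (by positivity)
      (by positivity)

/-! ### From a real to an integral monic polynomial -/

theorem exists_monic_real_of_capacity_lt_one {K : Set ℝ} (hK : IsCompact K)
    (hcap : capacity K < 1) : ∃ p : ℝ[X], p.Monic ∧ 0 < p.natDegree ∧
      ∃ r, 0 ≤ r ∧ r < 1 ∧ ∀ x ∈ K, |p.eval x| ≤ r := by
  obtain ⟨n, hn, hn1⟩ := (((tendsto_capacity hK).eventually_lt_const hcap).and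
    (eventually_ge_atTop 1)).exists
  have hlt : chebyshevNorm K n < 1 := by
    by_contra hge
    exact hn.not_ge (Real.one_le_rpow (not_lt.1 hge) (by positivity))
  obtain ⟨_, ⟨p, ⟨hp, hpn⟩, rfl⟩, hp1⟩ := exists_lt_of_csInf_lt
    (Set.Nonempty.image _ (show {P : ℝ[X] | P.Monic ∧ P.natDegree = n}.Nonempty from
      ⟨X ^ n, monic_X_pow n, natDegree_X_pow n⟩)) hlt
  exact ⟨p, hp, by omega, _, supNorm_nonneg _ _, hp1, fun x hx => le_supNorm hK p.continuous hx⟩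

theorem exists_sum_Ico_lt {c : ℕ → ℝ} (hc : Summable c) {ε : ℝ} (hε : 0 < ε) :
    ∃ m, ∀ N, m ≤ N → ∑ k ∈ Finset.Ico m N, c k < ε := by
  obtain ⟨m, hm⟩ := Metric.cauchySeq_iff'.1 hc.hasSum.tendsto_sum_nat.cauchySeq ε hε
  refine ⟨m, fun N hN => ?_⟩
  rw [Finset.sum_Ico_eq_sub _ hN]
  exact (le_abs_self _).trans_lt (by simpa [Real.dist_eq] using hm N hN)

/-- Fekete's theorem: if some monic real polynomial of positive degree has norm `< 1` on `K`, so
does some monic polynomial with integer coefficients. -/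
theorem exists_monic_int {K : Set ℝ} {M : ℝ} (hM : ∀ x ∈ K, |x| ≤ M) {p : ℝ[X]} (hp : p.Monic)
    (hdeg : 0 < p.natDegree) {r : ℝ} (hr0 : 0 ≤ r) (hr1 : r < 1)
    (hpr : ∀ x ∈ K, |p.eval x| ≤ r) : ∃ q : ℤ[X], q.Monic ∧ 0 < q.natDegree ∧
      ∃ r, 0 ≤ r ∧ r < 1 ∧ ∀ x ∈ K, |aeval x q| ≤ r := by
  obtain ⟨b, c, hb, hbd, hbc, -, hcs⟩ := exists_summable_basis hM hp hdeg hr0 hr1 hpr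
  obtain ⟨m, hm⟩ := exists_sum_Ico_lt hcs (show (0 : ℝ) < 1 / 8 by norm_num)
  obtain ⟨a, ha⟩ := exists_pow_lt_of_lt_one (show (0 : ℝ) < 1 / 8 by norm_num) hr1
  set n := p.natDegree with hn
  -- Strictly increasing exponents, large enough for `r ^ e k ≤ 1 / 8` and `m ≤ n * e k`.
  let e : ℕ → ℕ := fun k => a + m + 1 + k
  have hme : ∀ k, m ≤ n * e k := fun k =>
    (show m ≤ e k by simp only [e]; omega).trans (Nat.le_mul_of_pos_left _ hdeg)
  have hpe : ∀ k, ∀ x ∈ K, |p.eval x ^ e k| ≤ 1 / 8 := by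
    intro k x hx
    rw [abs_pow]
    refine (pow_le_pow_left₀ (abs_nonneg _) (hpr x hx) _).trans (le_trans ?_ ha.le)
    exact pow_le_pow_of_le_one hr0 hr1.le (by simp only [e]; omega)
  have hH : ∀ k, (p ^ e k - X ^ (n * e k)).degree < ((n * e k : ℕ) : WithBot ℕ) := by
    intro k
    have h1 : (p ^ e k).degree = ((n * e k : ℕ) : WithBot ℕ) := by
      rw [degree_eq_natDegree (hp.pow _).ne_zero, hp.natDegree_pow, mul_comm]
    rw [← h1]
    refine degree_sub_lt_left ?_ (hp.pow _).ne_zero ?_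
    · rw [h1, degree_X_pow]
    · rw [(hp.pow _).leadingCoeff, (monic_X_pow _).leadingCoeff]
  choose W L hW hL hWL using fun k =>
    exists_int_add_of_degree_lt hb hbd hbc (hme k) _ (hH k)
  obtain ⟨k, l, hkl, w, hw, -, hwL⟩ := exists_lt_abs_eval_sub_sub_lt hL M
    (show (0 : ℝ) < 1 / 8 by norm_num)
  have hlt : n * e k < n * e l := Nat.mul_lt_mul_of_pos_left (by simp only [e]; omega) hdeg
  have hrest : (W l - X ^ (n * e k) - W k + w).degree < ((n * e l : ℕ) : WithBot ℕ) := by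
    have hlt' : ((n * e k : ℕ) : WithBot ℕ) < ((n * e l : ℕ) : WithBot ℕ) := by exact_mod_cast hlt
    refine (degree_add_le _ _).trans_lt (max_lt ?_ (hw.trans_le (by exact_mod_cast hme l)))
    refine (degree_sub_le _ _).trans_lt (max_lt ?_ ((hW k).trans hlt'))
    refine (degree_sub_le _ _).trans_lt (max_lt (hW l) ?_)
    rwa [degree_X_pow]
  have hmonic : (X ^ (n * e l) + (W l - X ^ (n * e k) - W k + w)).Monic :=
    monic_X_pow_add hrest
  -- Five errors of `1 / 8`: two powers of `p`, two roundings, one Dirichlet approximation.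
  refine ⟨_, hmonic, ?_, 5 / 8, by norm_num, by norm_num, ?_⟩
  · have hd : (X ^ (n * e l) + (W l - X ^ (n * e k) - W k + w)).degree =
        ((n * e l : ℕ) : WithBot ℕ) := by
      rw [degree_add_eq_left_of_degree_lt (by rwa [degree_X_pow]), degree_X_pow]
    rw [natDegree_eq_of_degree_eq_some hd]
    omega
  · intro x hx
    have h1 := abs_le.1 ((hWL l x hx).trans (hm _ (hme l)).le)
    have h2 := abs_le.1 ((hWL k x hx).trans (hm _ (hme k)).le)
    have h3 := abs_lt.1 (hwL x (hM x hx))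
    have h4 := abs_le.1 (hpe l x hx)
    have h5 := abs_le.1 (hpe k x hx)
    simp only [eval_sub, eval_pow, eval_X] at h1 h2
    simp only [map_add, map_sub, map_pow, aeval_X]
    rw [abs_le]
    constructor <;> linarith [h1.1, h1.2, h2.1, h2.2, h3.1, h3.2, h4.1, h4.2, h5.1, h5.2]

/-! ### Cutting out the kernel by one monic polynomial -/

theorem mem_smallPolys_iff {K : Set ℝ} (hK : IsCompact K) {P : ℤ[X]} :
    P ∈ smallPolys K ↔ ∃ r, 0 ≤ r ∧ r < 1 ∧ ∀ x ∈ K, |aeval x P| ≤ r := by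
  refine ⟨fun h => ⟨_, supNorm_nonneg K (fun x => aeval x P), h, fun x hx =>
    le_supNorm hK (P.continuous_aeval) hx⟩, ?_⟩
  rintro ⟨r, hr0, hr1, h⟩
  refine lt_of_le_of_lt (Real.sSup_le ?_ hr0) hr1
  rintro _ ⟨x, hx, rfl⟩
  exact h x hx

/-- A sum of even powers vanishes at a real point only if both terms do. The witness is `s ^ (2 * k)
+ P ^ (2 * j)`, with `k` large enough for the first term to dominate in degree. -/
theorem exists_monic_add_pow {K : Set ℝ} (hK : IsCompact K) {s P : ℤ[X]} (hs : s.Monic)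
    (hd : 0 < s.natDegree) (hsK : s ∈ smallPolys K) (hP : P ∈ smallPolys K) :
    ∃ t : ℤ[X], t.Monic ∧ 0 < t.natDegree ∧ t ∈ smallPolys K ∧
      ∀ x : ℝ, aeval x t = 0 → aeval x s = 0 ∧ aeval x P = 0 := by
  obtain ⟨r, hr0, hr1, hr⟩ := (mem_smallPolys_iff hK).1 hsK
  obtain ⟨r', hr0', hr1', hr'⟩ := (mem_smallPolys_iff hK).1 hP
  obtain ⟨a, ha⟩ := exists_pow_lt_of_lt_one (show (0 : ℝ) < 1 / 4 by norm_num) hr1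
  obtain ⟨a', ha'⟩ := exists_pow_lt_of_lt_one (show (0 : ℝ) < 1 / 4 by norm_num) hr1'
  set j := a' + 1 with hj
  set k := a + 1 + j * (P.natDegree + 1) with hk
  have hdeg : (P ^ (2 * j)).natDegree < (s ^ (2 * k)).natDegree := by
    rw [hs.natDegree_pow]
    calc (P ^ (2 * j)).natDegree ≤ 2 * j * P.natDegree := natDegree_pow_le
      _ < 2 * k * 1 := by rw [hk]; nlinarith
      _ ≤ 2 * k * s.natDegree := Nat.mul_le_mul_left _ hd
  refine ⟨s ^ (2 * k) + P ^ (2 * j), (hs.pow _).add_of_left (degree_lt_degree hdeg), ?_, ?_, ?_⟩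
  · rw [natDegree_add_eq_left_of_natDegree_lt hdeg]
    omega
  · refine (mem_smallPolys_iff hK).2 ⟨1 / 2, by norm_num, by norm_num, fun x hx => ?_⟩
    have h1 : |aeval x s ^ (2 * k)| ≤ 1 / 4 := by
      rw [abs_pow]
      refine (pow_le_pow_left₀ (abs_nonneg _) (hr x hx) _).trans (le_trans ?_ ha.le)
      exact pow_le_pow_of_le_one hr0 hr1.le (by omega)
    have h2 : |aeval x P ^ (2 * j)| ≤ 1 / 4 := by
      rw [abs_pow]
      refine (pow_le_pow_left₀ (abs_nonneg _) (hr' x hx) _).trans (le_trans ?_ ha'.le)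
      exact pow_le_pow_of_le_one hr0' hr1'.le (by omega)
    simp only [map_add, map_pow]
    exact (abs_add_le _ _).trans (by linarith)
  · intro x hx
    simp only [map_add, map_pow, pow_mul] at hx
    have h1 : 0 ≤ ((aeval x s : ℝ) ^ 2) ^ k := by positivity
    have h2 : 0 ≤ ((aeval x P : ℝ) ^ 2) ^ j := by positivity
    have h3 : ((aeval x s : ℝ) ^ 2) ^ k = 0 := by linarith
    have h4 : ((aeval x P : ℝ) ^ 2) ^ j = 0 := by linarith
    exact ⟨pow_eq_zero_iff (two_ne_zero) |>.1 (pow_eq_zero_iff (by omega) |>.1 h3),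
      pow_eq_zero_iff (two_ne_zero) |>.1 (pow_eq_zero_iff (by omega) |>.1 h4)⟩

theorem finite_zeros {s : ℤ[X]} (hs : s ≠ 0) : {x : ℝ | aeval x s = 0}.Finite := by
  refine (s.rootSet_finite ℝ).subset fun x hx => ?_
  exact (mem_rootSet_of_ne hs).2 hx

/-- There is a monic polynomial in `B(K)` whose set of zeros on `K` is the Fekete kernel. -/
theorem exists_monic_zeros_eq_J {K : Set ℝ} (hK : IsCompact K) {q : ℤ[X]} (hq : q.Monic)
    (hd : 0 < q.natDegree) (hqK : q ∈ smallPolys K) :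
    ∃ s : ℤ[X], s.Monic ∧ 0 < s.natDegree ∧ s ∈ smallPolys K ∧
      ∀ x ∈ K, aeval x s = 0 → x ∈ J K := by
  -- The finitely many zeros of `q` in `K \ J K` are removed one at a time.
  have key : ∀ T : Set ℝ, T.Finite → T ⊆ K \ J K → ∃ s : ℤ[X], s.Monic ∧ 0 < s.natDegree ∧
      s ∈ smallPolys K ∧ ∀ x : ℝ, aeval x s = 0 → aeval x q = 0 ∧ x ∉ T := by
    intro T hT
    induction T, hT using Set.Finite.induction_on with
    | empty => exact fun _ => ⟨q, hq, hd, hqK, fun x hx => ⟨hx, by simp⟩⟩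
    | @insert z T _ _ ih =>
      intro hsub
      obtain ⟨s, hs, hsd, hsK, hs0⟩ := ih ((Set.subset_insert _ _).trans hsub)
      have hz := hsub (Set.mem_insert z T)
      obtain ⟨P, hP, hPz⟩ : ∃ P ∈ smallPolys K, aeval z P ≠ 0 := by
        by_contra! h
        exact hz.2 ⟨hz.1, h⟩
      obtain ⟨t, ht, htd, htK, ht0⟩ := exists_monic_add_pow hK hs hsd hsK hP
      refine ⟨t, ht, htd, htK, fun x hx => ⟨(hs0 x (ht0 x hx).1).1, ?_⟩⟩
      rintro (rfl | hxT)
      · exact hPz (ht0 x hx).2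
      · exact (hs0 x (ht0 x hx).1).2 hxT
  obtain ⟨s, hs, hsd, hsK, hs0⟩ := key ({x : ℝ | aeval x q = 0} ∩ (K \ J K))
    ((finite_zeros hq.ne_zero).inter_of_left _) Set.inter_subset_right
  refine ⟨s, hs, hsd, hsK, fun x hx h => ?_⟩
  by_contra hxJ
  exact (hs0 x h).2 ⟨(hs0 x h).1, hx, hxJ⟩

/-! ### Approximation of functions vanishing on the kernel -/

theorem exists_polynomial_near_of_isCompact {K : Set ℝ} (hK : IsCompact K) {f : ℝ → ℝ}
    (hf : ContinuousOn f K) {ε : ℝ} (hε : 0 < ε) : ∃ g : ℝ[X], ∀ x ∈ K, |f x - g.eval x| < ε := by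
  have : CompactSpace K := isCompact_iff_compactSpace.1 hK
  let F : C(K, ℝ) := ⟨K.domRestrict f, hf.domRestrict⟩
  have hF : F ∈ closure (polynomialFunctions K : Set C(K, ℝ)) := by
    rw [← Subalgebra.topologicalClosure_coe, polynomialFunctions.topologicalClosure]
    trivial
  obtain ⟨G, hG, hFG⟩ := Metric.mem_closure_iff.1 hF ε hε
  rw [polynomialFunctions_coe] at hG
  obtain ⟨g, rfl⟩ := hG
  exact ⟨g, fun x hx => (ContinuousMap.dist_lt_iff hε).1 hFG ⟨x, hx⟩⟩

/-- A continuous function that vanishes at the zeros of `u` is approximated by multiples of `u`. -/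
theorem exists_mul_near {K : Set ℝ} (hK : IsCompact K) {f u : ℝ → ℝ} (hf : ContinuousOn f K)
    (hu : ContinuousOn u K) (hu0 : ∀ x, 0 ≤ u x) (h : ∀ x ∈ K, u x = 0 → f x = 0) {ε : ℝ}
    (hε : 0 < ε) : ∃ g : ℝ → ℝ, ContinuousOn g K ∧ ∀ x ∈ K, |f x - u x * g x| ≤ ε := by
  obtain ⟨F, hF⟩ := hK.exists_bound_of_continuousOn hf
  have hK' : IsCompact (K ∩ f ⁻¹' {y | ε ≤ |y|}) :=
    hK.of_isClosed_subset (hf.preimage_isClosed_of_isClosed hK.isClosed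
      (isClosed_le continuous_const continuous_abs)) Set.inter_subset_left
  obtain ⟨u₀, hu₀, hmin⟩ : ∃ u₀, 0 < u₀ ∧ ∀ x ∈ K, ε ≤ |f x| → u₀ ≤ u x := by
    rcases (K ∩ f ⁻¹' {y | ε ≤ |y|}).eq_empty_or_nonempty with he | hne
    · exact ⟨1, one_pos, fun x hx hfx => absurd (show x ∈ K ∩ f ⁻¹' {y | ε ≤ |y|} from ⟨hx, hfx⟩)
        (by rw [he]; simp)⟩
    · obtain ⟨z, hz, hzmin⟩ := hK'.exists_isMinOn hne (hu.mono Set.inter_subset_left)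
      refine ⟨u z, (hu0 z).lt_of_ne' fun h0 => ?_, fun x hx hfx => hzmin ⟨hx, hfx⟩⟩
      have := hz.2
      simp only [Set.mem_preimage, Set.mem_ofPred_eq, h z hz.1 h0, abs_zero] at this
      linarith
  set δ := ε * u₀ / (|F| + 1) with hδ
  have hδ0 : 0 < δ := by positivity
  -- A regularised `f / u`: the error `f * δ / (u + δ)` is at most `ε` since either `|f| < ε` or `u
  -- ≥ u₀`.
  refine ⟨fun x => f x / (u x + δ), hf.div (hu.add continuousOn_const)
    fun x _ => (add_pos_of_nonneg_of_pos (hu0 x) hδ0).ne', fun x hx => ?_⟩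
  have hpos : 0 < u x + δ := add_pos_of_nonneg_of_pos (hu0 x) hδ0
  have heq : f x - u x * (f x / (u x + δ)) = f x * δ / (u x + δ) := by
    field_simp
    ring
  rw [heq, abs_div, abs_mul, abs_of_pos hδ0, abs_of_pos hpos, div_le_iff₀ hpos]
  have hux := hu0 x
  rcases le_or_gt ε (|f x|) with hge | hlt
  · have h1 : |f x| ≤ |F| + 1 := by
      have := hF x hx
      rw [Real.norm_eq_abs] at this
      linarith [le_abs_self F]
    calc |f x| * δ ≤ (|F| + 1) * δ := mul_le_mul_of_nonneg_right h1 hδ0.le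
      _ = ε * u₀ := by rw [hδ]; field_simp
      _ ≤ ε * (u x + δ) := mul_le_mul_of_nonneg_left (by linarith [hmin x hx hge]) hε.le
  · exact mul_le_mul hlt.le (by linarith) hδ0.le hε.le

/-- A continuous function that vanishes at the zeros of a monic polynomial `s` in `B(K)` is
approximated by polynomials with integer coefficients. -/
theorem exists_int_near_of_zeros {K : Set ℝ} (hK : IsCompact K) {s : ℤ[X]} (hs : s.Monic)
    (hd : 0 < s.natDegree) (hsK : s ∈ smallPolys K) {f : ℝ → ℝ} (hf : ContinuousOn f K)
    (h0 : ∀ x ∈ K, aeval x s = 0 → f x = 0) {ε : ℝ} (hε : 0 < ε) :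
    ∃ W : ℤ[X], ∀ x ∈ K, |f x - aeval x W| < ε := by
  obtain ⟨r, hr0, hr1, hr⟩ := (mem_smallPolys_iff hK).1 hsK
  obtain ⟨M, hM⟩ := hK.exists_bound_of_continuousOn continuousOn_id
  obtain ⟨b, c, hb, hbd, hbc, hc0, hcs⟩ := exists_summable_basis (K := K) (M := M) hM
    (hs.map (Int.castRingHom ℝ)) (by rwa [hs.natDegree_map]) hr0 hr1
    (fun x hx => by rw [← aeval_eq_eval_map_intCast]; exact hr x hx)
  have hC0 : 0 ≤ ∑' k, c k := tsum_nonneg hc0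
  -- `m` can be fixed before `g`, because rounding costs at most `∑' k, c k` whatever the
  -- polynomial.
  obtain ⟨m, hm⟩ := exists_pow_lt_of_lt_one
    (show 0 < ε / 4 / ((∑' k, c k) + 1) by positivity) hr1
  rw [lt_div_iff₀ (by positivity)] at hm
  have hu : ∀ x ∈ K, |(aeval x s : ℝ) ^ (2 * m)| ≤ r ^ m := by
    intro x hx
    rw [abs_pow]
    exact (pow_le_pow_left₀ (abs_nonneg _) (hr x hx) _).trans
      (pow_le_pow_of_le_one hr0 hr1.le (by omega))
  obtain ⟨g, hg, hfg⟩ := exists_mul_near hK hf (u := fun x => (aeval x s : ℝ) ^ (2 * m))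
    ((s.continuous_aeval.pow _).continuousOn) (fun x => by rw [pow_mul]; positivity)
    (fun x hx hx0 => h0 x hx (eq_zero_of_pow_eq_zero hx0)) (show 0 < ε / 4 by positivity)
  obtain ⟨G, hG⟩ := exists_polynomial_near_of_isCompact hK hg (show 0 < ε / 4 by positivity)
  -- Rounding goes down to degree `0`, so no remainder survives.
  obtain ⟨W, L, -, hL, hW⟩ := exists_int_add_of_degree_lt hb hbd hbc
    (Nat.zero_le (G.natDegree + 1)) G
    (degree_le_natDegree.trans_lt (by exact_mod_cast Nat.lt_succ_self _))
  have hL0 : L = 0 := by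
    by_contra hne
    rw [degree_eq_natDegree hne] at hL
    exact absurd (by exact_mod_cast hL : L.natDegree < 0) (Nat.not_lt_zero _)
  refine ⟨s ^ (2 * m) * W, fun x hx => ?_⟩
  have h1 := hfg x hx
  have h2 := (hG x hx).le
  have h3 : |G.eval x - aeval x W| ≤ ∑' k, c k := by
    have := hW x hx
    rw [hL0, eval_zero, sub_zero] at this
    exact this.trans (hcs.sum_le_tsum _ fun k _ => hc0 k)
  have hux := hu x hx
  set U : ℝ := (aeval x s : ℝ) ^ (2 * m) with hU
  have hU1 : |U| ≤ 1 := hux.trans (pow_le_one₀ hr0 hr1.le)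
  have h4 : |U * (g x - G.eval x)| ≤ ε / 4 := by
    rw [abs_mul]
    exact (mul_le_of_le_one_left (abs_nonneg _) hU1).trans h2
  have h5 : |U * (G.eval x - aeval x W)| ≤ ε / 4 := by
    rw [abs_mul]
    refine (mul_le_mul hux h3 (abs_nonneg _) (by positivity)).trans ?_
    nlinarith [pow_nonneg hr0 m]
  rw [map_mul, map_pow, ← hU]
  have h1' := abs_le.1 h1
  have h4' := abs_le.1 h4
  have h5' := abs_le.1 h5
  rw [abs_lt]
  constructor <;> linarith [h1'.1, h1'.2, h4'.1, h4'.2, h5'.1, h5'.2]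

/-- For a compact set of capacity `< 1` the Fekete kernel is finite, and each continuous function
that vanishes on it is approximated by polynomials with integer coefficients. -/
theorem J_finite_and_exists_int_near {K : Set ℝ} (hK : IsCompact K) (hcap : capacity K < 1) :
    (J K).Finite ∧ ∀ f : ℝ → ℝ, ContinuousOn f K → (∀ x ∈ J K, f x = 0) → ∀ ε : ℝ, 0 < ε →
      ∃ W : ℤ[X], ∀ x ∈ K, |f x - aeval x W| < ε := by
  obtain ⟨M, hM⟩ := hK.exists_bound_of_continuousOn continuousOn_id
  obtain ⟨p, hp, hpd, r, hr0, hr1, hpr⟩ := exists_monic_real_of_capacity_lt_one hK hcap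
  obtain ⟨q, hq, hqd, hqr⟩ := exists_monic_int (K := K) (M := M) hM hp hpd hr0 hr1 hpr
  obtain ⟨s, hs, hsd, hsK, hs0⟩ := exists_monic_zeros_eq_J hK hq hqd
    ((mem_smallPolys_iff hK).2 hqr)
  exact ⟨(finite_zeros hs.ne_zero).subset fun x hx => hx.2 s hsK, fun f hf h0 ε hε =>
    exists_int_near_of_zeros hK hs hsd hsK hf (fun x hx h => h0 x (hs0 x hx h)) hε⟩

/-! ### Conjugates of points of the kernel -/

/-- A polynomial with integer coefficients whose values on the Fekete kernel are `< 1` in absolute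
value vanishes there. -/
theorem aeval_eq_zero_of_abs_lt_one {K : Set ℝ} (hK : IsCompact K) (hcap : capacity K < 1)
    {R : ℤ[X]} (hR : ∀ x ∈ J K, |aeval x R| < 1) {x : ℝ} (hx : x ∈ J K) : aeval x R = 0 := by
  obtain ⟨hfin, happ⟩ := J_finite_and_exists_int_near hK hcap
  obtain ⟨z, hz, hzmax⟩ := hfin.exists_maximalFor (fun y : ℝ => |aeval y R|) _ ⟨x, hx⟩
  set ρ : ℝ := |aeval z R| with hρ
  have hle : ∀ y ∈ J K, |aeval y R| ≤ ρ := fun y hy => by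
    by_contra! hlt
    exact hlt.not_ge (hzmax hy hlt.le)
  have hρ0 : 0 ≤ ρ := abs_nonneg _
  have hρ1 : ρ < 1 := hR z hz
  by_contra hne
  have hpos : 0 < |(aeval x R : ℝ)| := abs_pos.2 hne
  -- `ε < 1 - ρ` puts `W + R` in `B(K)`, so `W x = -R x`; `ε < |R x|` then contradicts `|W x| < ε`.
  obtain ⟨ε, hε0, hε⟩ := exists_between (lt_min hpos (sub_pos.2 hρ1))
  -- Truncation at `±ρ` leaves the values of `R` on `J K` unchanged.
  let f : ℝ → ℝ := fun y => max (-ρ) (min ρ (aeval y R))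
  have hfc : Continuous f := by
    have := R.continuous_aeval (A := ℝ)
    fun_prop
  have hfJ : ∀ y ∈ J K, f y = aeval y R := fun y hy => by
    have := abs_le.1 (hle y hy)
    simp only [f, min_eq_right this.2, max_eq_right this.1]
  have hfρ : ∀ y, |f y| ≤ ρ := fun y =>
    abs_le.2 ⟨le_max_left _ _, max_le (by linarith) (min_le_left _ _)⟩
  obtain ⟨W, hW⟩ := happ (fun y => f y - aeval y R)
    (hfc.sub R.continuous_aeval).continuousOn (fun y hy => by rw [hfJ y hy, sub_self]) ε hε0
  have hmem : W + R ∈ smallPolys K := by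
    refine (mem_smallPolys_iff hK).2 ⟨ρ + ε, by positivity,
      by linarith [hε.trans_le (min_le_right _ _)], fun y hy => ?_⟩
    have h1 := abs_lt.1 (hW y hy)
    have h2 := abs_le.1 (hfρ y)
    rw [map_add, abs_le]
    constructor <;> linarith [h1.1, h1.2, h2.1, h2.2]
  have h1 := hW x hx.1
  have h2 := hx.2 _ hmem
  rw [map_add] at h2
  simp only [hfJ x hx, sub_self, zero_sub, abs_neg, eq_neg_of_add_eq_zero_left h2] at h1
  exact lt_asymm h1 (hε.trans_le (min_le_left _ _))

/-- For a finite set `S` of real numbers there is a nonzero polynomial with integer coefficients, of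
degree at most the cardinality of `S`, that is small on `S`. -/
theorem exists_int_small_on_finset (S : Finset ℝ) : ∃ R : ℤ[X], R ≠ 0 ∧ R.natDegree ≤ S.card ∧
    ∀ x ∈ S, |aeval x R| < 1 := by
  set v : ℝ[X] := ∏ y ∈ S, (X - C y) with hv
  have hvm : v.Monic := monic_prod_X_sub_C _ _
  have hvd : v.natDegree = S.card := natDegree_finsetProd_X_sub_C_eq_card _ _
  have hv0 : ∀ x ∈ S, v.eval x = 0 := fun x hx => by
    rw [hv, eval_prod]
    exact Finset.prod_eq_zero hx (by simp)
  -- All multiples of `v` vanish on `S`, so `w` is small there; its top coefficient is within `1` of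
  -- `l - k ≥ 1`, hence nonzero.
  obtain ⟨k, l, hkl, w, hw, hc, hwx⟩ := exists_lt_abs_eval_sub_sub_lt (d := S.card + 1)
    (G := fun k => C (k : ℝ) * v) (fun k => by
      refine degree_lt_iff_coeff_zero _ _ |>.2 fun i hi => ?_
      rw [coeff_C_mul, coeff_eq_zero_of_natDegree_lt (by omega), mul_zero])
    (∑ y ∈ S, |y|) one_pos
  refine ⟨w, ?_, ?_, fun x hx => ?_⟩
  · rintro rfl
    have h1 := hc S.card
    have h2 : v.coeff S.card = 1 := by rw [← hvd]; exact hvm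
    simp only [coeff_sub, coeff_C_mul, h2, coeff_zero, Int.cast_zero, sub_zero, mul_one] at h1
    have h3 : (k : ℝ) + 1 ≤ l := by exact_mod_cast hkl
    linarith [le_abs_self ((l : ℝ) - k)]
  · exact natDegree_le_of_degree_le (Order.lt_succ_iff.1 (by exact_mod_cast hw))
  · have h1 := hwx x (Finset.single_le_sum (f := fun y : ℝ => |y|) (fun y _ => abs_nonneg y) hx)
    simpa [hv0 x hx] using h1

theorem aeval_eq_zero_of_isConjRoot {x : ℝ} {z : ℂ} (h : IsConjRoot ℚ (x : ℂ) z) {R : ℤ[X]}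
    (hR : aeval x R = 0) : aeval z R = 0 := by
  have h1 : aeval (x : ℂ) (R.map (Int.castRingHom ℚ)) = 0 := by
    have : aeval (x : ℂ) R = ((aeval x R : ℝ) : ℂ) := aeval_algebraMap_apply ℂ x R
    rw [← algebraMap_int_eq, aeval_map_algebraMap, this, hR, Complex.ofReal_zero]
  obtain ⟨T, hT⟩ := minpoly.dvd ℚ _ h1
  have h2 : aeval z (R.map (Int.castRingHom ℚ)) = 0 := by
    rw [hT, map_mul, h.aeval_eq_zero, zero_mul]
  rwa [← algebraMap_int_eq, aeval_map_algebraMap] at h2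

/-- The Fekete kernel is closed under conjugation. -/
theorem exists_mem_J_of_isConjRoot {K : Set ℝ} (hK : IsCompact K) (hcap : capacity K < 1) {x : ℝ}
    (hx : x ∈ J K) {z : ℂ} (hz : IsConjRoot ℚ (x : ℂ) z) : ∃ y ∈ J K, (y : ℂ) = z := by
  classical
  obtain ⟨hfin, -⟩ := J_finite_and_exists_int_near hK hcap
  by_contra! hne
  obtain ⟨R, hR0, hRd, hR⟩ := exists_int_small_on_finset hfin.toFinset
  have hJ : ∀ y ∈ J K, aeval y R = 0 := fun y hy =>
    aeval_eq_zero_of_abs_lt_one hK hcap (fun y hy => hR y (hfin.mem_toFinset.2 hy)) hy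
  -- A conjugate outside `J K` would give `R` more roots than its degree.
  set S : Finset ℂ := insert z (hfin.toFinset.image Complex.ofReal) with hS
  have hcard : S.card = hfin.toFinset.card + 1 := by
    rw [hS, Finset.card_insert_of_notMem, Finset.card_image_of_injective _ Complex.ofReal_injective]
    simpa using hne
  have hroots : S.val ⊆ (R.aroots ℂ) := by
    intro y hy
    rw [mem_aroots]
    refine ⟨hR0, ?_⟩
    rcases Finset.mem_insert.1 hy with rfl | hy
    · exact aeval_eq_zero_of_isConjRoot hz (hJ x hx)
    · obtain ⟨t, ht, rfl⟩ := Finset.mem_image.1 hy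
      have : aeval (t : ℂ) R = ((aeval t R : ℝ) : ℂ) := aeval_algebraMap_apply ℂ t R
      rw [this, hJ t (hfin.mem_toFinset.1 ht), Complex.ofReal_zero]
  have h1 := Multiset.card_le_card ((Multiset.le_iff_subset S.nodup).2 hroots)
  have h2 : Multiset.card (R.aroots ℂ) ≤ R.natDegree := (card_roots' _).trans natDegree_map_le
  have h3 : Multiset.card S.val = S.card := rfl
  omega

theorem J₀_eq_J {K : Set ℝ} (hK : IsCompact K) (hcap : capacity K < 1) : J₀ K = J K :=
  Set.Subset.antisymm (fun _ hx => hx.1) fun _ hx => ⟨hx, fun _ hz =>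
    (exists_mem_J_of_isConjRoot hK hcap hx hz).imp fun _ hy => ⟨hy.1.1, hy.2⟩⟩

/-! ### Approximable versus interpolable -/

theorem IsApproximable.isInterpolable_J {K : Set ℝ} (hK : IsCompact K) {f : ℝ → ℝ}
    (h : IsApproximable K f) : IsInterpolable (J K) f := by
  obtain ⟨P, hP⟩ := h
  obtain ⟨N, hN⟩ := eventually_atTop.1 (Metric.tendstoUniformlyOn_iff.1 hP (1 / 4) (by norm_num))
  have heq : ∀ n, N ≤ n → ∀ x ∈ J K, aeval x (P n) = aeval x (P N) := by
    intro n hn x hx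
    have hmem : P n - P N ∈ smallPolys K := by
      refine (mem_smallPolys_iff hK).2 ⟨1 / 2, by norm_num, by norm_num, fun y hy => ?_⟩
      have h1 := abs_lt.1 (hN n hn y hy)
      have h2 := abs_lt.1 (hN N le_rfl y hy)
      rw [map_sub, abs_le]
      constructor <;> linarith [h1.1, h1.2, h2.1, h2.2]
    have := hx.2 _ hmem
    rwa [map_sub, sub_eq_zero] at this
  refine ⟨P N, fun x hx => tendsto_nhds_unique (hP.tendsto_at hx.1)
    (tendsto_const_nhds.congr' ?_)⟩
  filter_upwards [eventually_ge_atTop N] with n hn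
  exact (heq n hn x hx).symm

theorem IsInterpolable.isApproximable {K : Set ℝ} (hK : IsCompact K) (hcap : capacity K < 1)
    {f : ℝ → ℝ} (hf : ContinuousOn f K) (h : IsInterpolable (J K) f) : IsApproximable K f := by
  obtain ⟨R, hR⟩ := h
  choose W hW using fun n : ℕ => (J_finite_and_exists_int_near hK hcap).2
    (fun x => f x - aeval x R) (hf.sub R.continuous_aeval.continuousOn)
    (fun x hx => by rw [hR x hx, sub_self]) (1 / ((n : ℝ) + 1)) Nat.one_div_pos_of_nat
  refine ⟨fun n => R + W n, Metric.tendstoUniformlyOn_iff.2 fun ε hε => ?_⟩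
  filter_upwards [(tendsto_one_div_add_atTop_nhds_zero_nat (𝕜 := ℝ)).eventually_lt_const hε]
    with n hn x hx
  rw [Real.dist_eq, map_add, ← sub_sub]
  exact (hW n x hx).trans hn

end FeketeKernel

theorem mainTheorem2 (K : Set ℝ) (hK : IsCompact K) (hKinf : K.Infinite)
    (hcap : FeketeKernel.capacity K < 1) :
    FeketeKernel.J₀ K = FeketeKernel.J K ∧
      ∀ f : ℝ → ℝ, ContinuousOn f K →
        (FeketeKernel.IsApproximable K f ↔
          FeketeKernel.IsInterpolable (FeketeKernel.J₀ K) f) := by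
  refine ⟨FeketeKernel.J₀_eq_J hK hcap, fun f hf => ?_⟩
  rw [FeketeKernel.J₀_eq_J hK hcap]
  exact ⟨FeketeKernel.IsApproximable.isInterpolable_J hK,
    FeketeKernel.IsInterpolable.isApproximable hK hcap hf⟩
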